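/- Consider a polling system with $N$ stations (ONUs) and $L\ge 1$ servers (wavelengths). ONU $i$ has finitely many queues $(i,j)$, with maximum grants $d_{ij}>0$, and a switch overhead $\Delta_i>0$. At every time each wavelength is in exactly one visit to an ONU, and each ONU, having one tunable transmitter, is attended by at most one wavelength. In a visit to ONU $i$ the wavelength transmits from its queues one after the other, each queue $(i,j)$ for a time that exceeds neither $d_{ij}$ nor the work present in the queue when its transmission begins (in particular, limited-gated service is allowed); then follows the overhead $\Delta_i$, after which the wavelength moves immediately to some ONU that is free (possibly the same one). The choice of the next ONU is arbitrary (in particular, periodic or random polling), provided that no ONU is left unvisited forever. Work arrives at queue $(i,j)$ according to a stationary random measure of finite intensity $\rho_{ij}$ (in units of the rate of one wavelength); let $\rho=\sum_{i,j}\rho_{ij}$. Assume that the system is at equilibrium: visits, arrivals and (finite) backlogs are jointly stationary processes on the time axis $\mathbb R$. A vacation of ONU $i$ is the time $\Theta_i\ge 0$ between the end of a visit to ONU $i$ and the start of the next visit to it. The rate $\lambda_i$ of visits to ONU $i$ is the expected number of its visits that start in $(0,1]$, and $\mathbb E[\Theta_i]$ is the mean over these visits (Palm expectation), i.e. the expected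 total length of the vacations ending in $(0,1]$ divided by $\lambda_i$. Let $$\theta=\frac{\sum_i\lambda_i\,\mathbb E[\Theta_i]}{\sum_i\lambda_i},\qquad \delta=\frac{\sum_i\lambda_i\Delta_i}{\sum_i\lambda_i}$$ be the mean vacation interval and the mean switch overhead of a visit over all ONUs. Then $0<\lambda_i<\infty$ and $\mathbb E[\Theta_i]<\infty$ for all $i$, $\theta<\infty$, $0<\delta<\infty$, $\rho<L$, and $$\theta=\frac{(N-L)\,\delta}{L-\rho}.$$ In particular, if all $\mathbb E[\Theta_i]$ are equal, their common value is $(N-L)\delta/(L-\rho)$. -/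

import Mathlib

open MeasureTheory Set
open scoped ENNReal

noncomputable section

/-- Parameters of a WDM PON with `N` ONUs and `L` wavelengths, each ONU having one tunable
transmitter: ONU `i` has `numQueues i` user queues, queue `(i, j)` has the maximum grant
`maxGrant i j` per visit (in seconds), and every visit to ONU `i` costs the switch overhead
`overhead i`. -/
structure PON (N L : ℕ) where
  numQueues : Fin N → ℕ
  maxGrant : (i : Fin N) → Fin (numQueues i) → ℝ
  overhead : Fin N → ℝ
  maxGrant_pos : ∀ i j, 0 < maxGrant i j
  overhead_pos : ∀ i, 0 < overhead i

namespace PON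

variable {N L : ℕ}

/-- A visit of some wavelength to ONU `i`: the time at which it starts and the transmission
times granted to the queues of the ONU. -/
structure Visit (P : PON N L) (i : Fin N) where
  start : ℝ
  grant : Fin (P.numQueues i) → ℝ

namespace Visit

variable {P : PON N L} {i : Fin N}

/-- The queues are served in the order of their index; `turn v j` is the time at which the
transmission of queue `j` begins. -/
def turn (v : P.Visit i) (j : Fin (P.numQueues i)) : ℝ :=
  v.start + ∑ k ∈ Finset.Iio j, v.grant k

/-- The period in which queue `j` transmits during the visit. -/
def transmission (v : P.Visit i) (j : Fin (P.numQueues i)) : Set ℝ :=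
  Ico (v.turn j) (v.turn j + v.grant j)

/-- The time at which the wavelength leaves: after all transmissions and the overhead. -/
def finish (v : P.Visit i) : ℝ :=
  v.start + ∑ j, v.grant j + P.overhead i

/-- The period in which the wavelength is present at the ONU. -/
def period (v : P.Visit i) : Set ℝ :=
  Ico v.start v.finish

/-- The same visit, `t` time units later. -/
def delay (t : ℝ) (v : P.Visit i) : P.Visit i :=
  ⟨v.start + t, v.grant⟩

end Visit

/-- The times at which queue `(i, j)` is transmitting data, when `visits l i` is the set of
visits of wavelength `l` to ONU `i`. -/
def transmitting (P : PON N L) (visits : Fin L → (i : Fin N) → Set (P.Visit i))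
    (i : Fin N) (j : Fin (P.numQueues i)) : Set ℝ :=
  {t | ∃ l, ∃ v ∈ visits l i, t ∈ v.transmission j}

/-- Trajectories, over the time axis `ℝ`, of the multiserver polling system in which at most
one wavelength at a time is present at any ONU.  Here `visits l i` is the set of visits of
wavelength `l` to ONU `i`, `arrived i j` is the measure on the time axis that gives the work
brought to queue `(i, j)` by the arriving packets (a packet of transmission time `x` arriving
at time `t` is an atom of mass `x` at `t`), and `backlog i j t` is the work in queue `(i, j)`
at time `t`.

The order in which a wavelength visits the free ONUs is arbitrary, provided that no ONU is left
unvisited forever; this covers periodic polling and random polling.  Grants obey the limits and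
are covered by the work present when the transmission of the queue begins; this covers
limited-gated service, whatever the instant before the transmission at which the gate closes. -/
structure IsTrajectory (P : PON N L) (visits : Fin L → (i : Fin N) → Set (P.Visit i))
    (arrived : (i : Fin N) → Fin (P.numQueues i) → Measure ℝ)
    (backlog : (i : Fin N) → Fin (P.numQueues i) → ℝ → ℝ) : Prop where
  /-- A wavelength is at any time in exactly one visit: moving to the next ONU is immediate. -/
  wavelength_busy : ∀ l t, ∃! x : (i : Fin N) × P.Visit i, x.2 ∈ visits l x.1 ∧ t ∈ x.2.period
  /-- One tunable transmitter per ONU. -/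
  one_transmitter : ∀ i t,
    {x : Fin L × P.Visit i | x.2 ∈ visits x.1 i ∧ t ∈ x.2.period}.Subsingleton
  visited_after : ∀ i t, ∃ l, ∃ v ∈ visits l i, t < v.start
  visited_before : ∀ i t, ∃ l, ∃ v ∈ visits l i, v.start < t
  grant_nonneg : ∀ l i, ∀ v ∈ visits l i, ∀ j, 0 ≤ v.grant j
  grant_le_max : ∀ l i, ∀ v ∈ visits l i, ∀ j, v.grant j ≤ P.maxGrant i j
  grant_le_backlog : ∀ l i, ∀ v ∈ visits l i, ∀ j, v.grant j ≤ backlog i j (v.turn j)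
  backlog_nonneg : ∀ i j t, 0 ≤ backlog i j t
  arrived_ne_top : ∀ i j s t, arrived i j (Ioc s t) ≠ ∞
  /-- Work arrives according to `arrived` and a transmission removes it at unit rate. -/
  backlog_balance : ∀ i j s t, s ≤ t →
    backlog i j t = backlog i j s + (arrived i j).real (Ioc s t)
      - volume.real (Ioc s t ∩ P.transmitting visits i j)

/-- The polling system at equilibrium, on a probability space `(Ω, μ)` with a measure preserving
flow: `flow t ω` is `ω` seen from time `t`, so that visits, arrivals and backlogs are jointly
stationary.  The backlog at time `t` is `backlog (flow t ω)`; that it is finite and stationary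
is the stability of the system. -/
structure Equilibrium (P : PON N L) {Ω : Type*} [MeasurableSpace Ω] (μ : Measure Ω) where
  flow : ℝ → Ω → Ω
  flow_zero : ∀ ω, flow 0 ω = ω
  flow_add : ∀ s t ω, flow (s + t) ω = flow s (flow t ω)
  flow_preserving : ∀ t, MeasurePreserving (flow t) μ μ
  visits : Ω → Fin L → (i : Fin N) → Set (P.Visit i)
  visits_flow : ∀ t ω l i, visits (flow t ω) l i = {v | v.delay t ∈ visits ω l i}
  visits_measurable : ∀ l i a b, ∀ G : Set (Fin (P.numQueues i) → ℝ), MeasurableSet G →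
    MeasurableSet {ω | ∃ v ∈ visits ω l i, v.start ∈ Ioc a b ∧ v.grant ∈ G}
  arrived : Ω → (i : Fin N) → Fin (P.numQueues i) → Measure ℝ
  arrived_flow : ∀ t ω i j, arrived (flow t ω) i j = (arrived ω i j).map (fun s => s - t)
  arrived_measurable : ∀ i j, Measurable fun ω => arrived ω i j
  /-- The arrival process has a well defined rate. -/
  rate_ne_top : ∀ i j, ∫⁻ ω, arrived ω i j (Ioc 0 1) ∂μ ≠ ∞
  backlog : Ω → (i : Fin N) → Fin (P.numQueues i) → ℝ
  backlog_measurable : ∀ i j, Measurable fun ω => backlog ω i j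
  isTrajectory : ∀ᵐ ω ∂μ,
    P.IsTrajectory (visits ω) (arrived ω) (fun i j t => backlog (flow t ω) i j)

namespace Equilibrium

variable {P : PON N L} {Ω : Type*} [MeasurableSpace Ω] {μ : Measure Ω}

/-- The traffic intensity of queue `(i, j)`: mean work brought per unit of time. -/
def queueIntensity (E : P.Equilibrium μ) (i : Fin N) (j : Fin (P.numQueues i)) : ℝ :=
  (∫⁻ ω, E.arrived ω i j (Ioc 0 1) ∂μ).toReal

/-- The total traffic intensity `ρ`. -/
def intensity (E : P.Equilibrium μ) : ℝ :=
  ∑ i, ∑ j, E.queueIntensity i j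

/-- The vacation of ONU `i` that ends when the visit `v` begins: the time from the end of the
preceding visit to ONU `i` (by any wavelength) to the start of `v`. -/
def vacation (E : P.Equilibrium μ) (ω : Ω) (i : Fin N) (v : P.Visit i) : ℝ :=
  v.start - sSup {e | ∃ l, ∃ u ∈ E.visits ω l i, e = u.finish ∧ e ≤ v.start}

/-- The expected sum of the values `f ω v` over the visits `v` to ONU `i` that start in a unit
of time. -/
def visitSum (E : P.Equilibrium μ) (i : Fin N) (f : Ω → P.Visit i → ℝ) : ℝ≥0∞ :=
  ∫⁻ ω, ∑ l, ∑' v : {v : P.Visit i // v ∈ E.visits ω l i ∧ v.start ∈ Ioc (0 : ℝ) 1},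
    ENNReal.ofReal (f ω v) ∂μ

/-- The rate of visits to ONU `i`, which is also the rate of its vacations. -/
def visitRate (E : P.Equilibrium μ) (i : Fin N) : ℝ≥0∞ :=
  E.visitSum i fun _ _ => 1

/-- The mean vacation interval of ONU `i`: mean with respect to the Palm distribution of the
visits to ONU `i`. -/
def meanVacationAt (E : P.Equilibrium μ) (i : Fin N) : ℝ≥0∞ :=
  E.visitSum i (fun ω v => E.vacation ω i v) / E.visitRate i

/-- The mean vacation interval over all ONUs (Palm distribution of all visits). -/
def meanVacation (E : P.Equilibrium μ) : ℝ≥0∞ :=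
  (∑ i, E.visitSum i (fun ω v => E.vacation ω i v)) / ∑ i, E.visitRate i

/-- The mean switch overhead of a visit over all ONUs (Palm distribution of all visits). -/
def meanOverhead (E : P.Equilibrium μ) : ℝ≥0∞ :=
  (∑ i, E.visitSum i (fun _ _ => P.overhead i)) / ∑ i, E.visitRate i

end Equilibrium

end PON

end

/-! The formula comes from counting time in `(0, 1]` and averaging. At each instant an ONU is either
on vacation or holds exactly one wavelength, and each wavelength is at exactly one ONU. With `p_i`
the mean presence at ONU `i`, this gives `λ_i E[Θ_i] + p_i = 1` and `∑ p_i = L`, hence `∑ λ_i E[Θ_i]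
= N - L` (`visitSum_vacation_add_meanPresence`, `sum_meanPresence`). A visit consists of grants and
overhead, and at equilibrium grants balance arrivals, so `p_i = ρ_i + λ_i Δ_i` (`meanPresence_eq`)
and `∑ λ_i Δ_i = L - ρ`. The quotient of the two sums is the claim.

Two tools pass from paths to means per visit. Mass transport (`lintegral_pointSum_length`) trades
the length of intervals attached to visits for the time they cover. The coboundary lemma
(`lintegral_eq_of_add_comp_eq_add`) removes the boundary terms, backlog and vacation age, which need
not be integrable. Measurability rests on the fact that at most one visit to ONU `i` starts in a
window of length `Δ_i` (`aemeasurable_pointSum`). -/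

/-! ### Gaps between separated intervals -/

/-- A family of pairwise disjoint intervals `[s x, e x)` of lengths bounded below, with starting
points that are unbounded in both directions. -/
structure SeparatedIntervals {ι : Type*} (s e : ι → ℝ) (δ : ℝ) : Prop where
  pos : 0 < δ
  length : ∀ x, s x + δ ≤ e x
  disjoint : ∀ x y t, t ∈ Ico (s x) (e x) → t ∈ Ico (s y) (e y) → x = y
  after : ∀ t, ∃ x, t < s x
  before : ∀ t, ∃ x, s x < t

namespace SeparatedIntervals

variable {ι : Type*} {s e : ι → ℝ} {δ : ℝ}

/-- The right end of the last interval that ends before `t`. -/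
noncomputable def lastEnd (e : ι → ℝ) (t : ℝ) : ℝ := sSup {a | ∃ y, a = e y ∧ a ≤ t}

/-- The time since the end of the last interval that starts before `t`. -/
noncomputable def age (s e : ι → ℝ) (t : ℝ) : ℝ≥0∞ :=
  ⨅ x, ⨅ _ : s x ≤ t, ENNReal.ofReal (t - e x)

theorem start_lt (h : SeparatedIntervals s e δ) (x : ι) : s x < e x := by
  linarith [h.length x, h.pos]

theorem end_le_start (h : SeparatedIntervals s e δ) {x y : ι} (hxy : s x < s y) :
    e x ≤ s y := by
  by_contra! hlt
  have := h.disjoint x y (s y) ⟨hxy.le, hlt⟩ ⟨le_rfl, h.start_lt y⟩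
  subst this
  exact lt_irrefl _ hxy

theorem start_injective (h : SeparatedIntervals s e δ) : Function.Injective s := fun x y hxy =>
  h.disjoint x y (s x) ⟨le_rfl, h.start_lt x⟩ ⟨hxy.ge, hxy ▸ h.start_lt y⟩

theorem pairwise_disjoint (h : SeparatedIntervals s e δ) :
    Pairwise (Function.onFun Disjoint fun x => Ico (s x) (e x)) := fun x y hxy =>
  Set.disjoint_left.2 fun t hx hy => hxy (h.disjoint x y t hx hy)

theorem countable (h : SeparatedIntervals s e δ) : Countable ι := by
  rw [← countable_univ_iff]
  refine PairwiseDisjoint.countable_of_nonempty_interior (s := fun x => Ico (s x) (e x))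
    (h.pairwise_disjoint.set_pairwise _) fun x _ => ?_
  rw [interior_Ico]
  exact nonempty_Ioo.2 (h.start_lt x)

/-- A start within `δ` of the infimum of the later starts is already minimal: an earlier one would
precede it by at least `δ` and so lie below the infimum. -/
theorem exists_first (h : SeparatedIntervals s e δ) (t : ℝ) :
    ∃ x, t < s x ∧ ∀ y, t < s y → s x ≤ s y := by
  set S := {a | ∃ x, a = s x ∧ t < s x} with hS
  obtain ⟨x₀, hx₀⟩ := h.after t
  have hne : S.Nonempty := ⟨s x₀, x₀, rfl, hx₀⟩
  have hb : BddBelow S := ⟨t, by rintro _ ⟨x, rfl, hx⟩; exact hx.le⟩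
  obtain ⟨_, ⟨x, rfl, hx⟩, hlt⟩ := exists_lt_of_csInf_lt hne (lt_add_of_pos_right (sInf S) h.pos)
  refine ⟨x, hx, fun y hy => ?_⟩
  by_contra! hyx
  have h1 := h.end_le_start hyx
  have h2 := csInf_le hb (show s y ∈ S from ⟨y, rfl, hy⟩)
  linarith [h.length y]

theorem bddAbove_ends (t : ℝ) : BddAbove {a | ∃ y, a = e y ∧ a ≤ t} :=
  ⟨t, by rintro _ ⟨y, rfl, hy⟩; exact hy⟩

theorem le_lastEnd {t : ℝ} {y : ι} (hy : e y ≤ t) : e y ≤ lastEnd e t :=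
  le_csSup (bddAbove_ends t) ⟨y, rfl, hy⟩

theorem ends_nonempty (h : SeparatedIntervals s e δ) (x : ι) :
    {a | ∃ y, a = e y ∧ a ≤ s x}.Nonempty := by
  obtain ⟨y, hy⟩ := h.before (s x)
  exact ⟨e y, y, rfl, h.end_le_start hy⟩

/-- The gap before the interval `x`. -/
def gap (s e : ι → ℝ) (x : ι) : Set ℝ := Ico (lastEnd e (s x)) (s x)

theorem gap_pairwise_disjoint (h : SeparatedIntervals s e δ) :
    Pairwise (Function.onFun Disjoint (gap s e)) := by
  have key : ∀ x y, s x < s y → Disjoint (gap s e x) (gap s e y) := fun x y hxy =>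
    Set.disjoint_left.2 fun t hx hy => by
      have := le_lastEnd (h.end_le_start hxy)
      linarith [hx.2, hy.1, h.start_lt x]
  intro x y hxy
  rcases lt_trichotomy (s x) (s y) with h1 | h1 | h1
  · exact key x y h1
  · exact absurd (h.start_injective h1) hxy
  · exact (key y x h1).symm

theorem iUnion_gap (h : SeparatedIntervals s e δ) :
    ⋃ x, gap s e x = (⋃ x, Ico (s x) (e x))ᶜ := by
  ext t
  simp only [mem_iUnion, mem_compl_iff, not_exists]
  constructor
  · rintro ⟨x, hx⟩ y hy
    have h1 : s y < s x := hy.1.trans_lt hx.2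
    have := le_lastEnd (h.end_le_start h1)
    linarith [hx.1, hy.2]
  · intro ht
    obtain ⟨x, hx, hmin⟩ := h.exists_first t
    refine ⟨x, csSup_le (h.ends_nonempty x) ?_, hx⟩
    rintro _ ⟨y, rfl, hy⟩
    by_contra! hlt
    have h1 : ¬ t < s y := fun h2 => by linarith [hmin y h2, h.start_lt y]
    exact ht y ⟨not_lt.1 h1, hlt⟩

theorem age_ne_top (h : SeparatedIntervals s e δ) (t : ℝ) : age s e t ≠ ∞ := by
  obtain ⟨x, hx⟩ := h.before t
  exact ne_top_of_le_ne_top ENNReal.ofReal_ne_top (iInf₂_le x hx.le)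

/-- Only the gap before the first interval starting after `t` can both end after `t` and meet `Iic
t`. If `t` lies inside an interval, both sides vanish, the left one by truncation in
`ENNReal.ofReal`. -/
theorem age_eq_tsum (h : SeparatedIntervals s e δ) (t : ℝ) :
    age s e t = ∑' x, {x | t < s x}.indicator (fun x => volume (gap s e x ∩ Iic t)) x := by
  obtain ⟨x, hx, hmin⟩ := h.exists_first t
  rw [tsum_eq_single x]
  · have hset : gap s e x ∩ Iic t = Icc (lastEnd e (s x)) t := by
      ext u
      simp only [gap, mem_inter_iff, mem_Ico, mem_Iic, mem_Icc]
      exact ⟨fun hu => ⟨hu.1.1, hu.2⟩, fun hu => ⟨⟨hu.1, hu.2.trans_lt hx⟩, hu.2⟩⟩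
    rw [indicator_of_mem (by exact hx), hset, Real.volume_Icc]
    -- No interval starts between `t` and `s x`, so the infimum defining `age` and the supremum
    -- defining `lastEnd` range over the same intervals.
    have hiff : ∀ y, s y ≤ t ↔ e y ≤ s x := fun y =>
      ⟨fun hy => h.end_le_start (hy.trans_lt hx), fun hy => by
        by_contra! hlt
        linarith [hmin y hlt, h.start_lt y]⟩
    apply le_antisymm
    · refine le_of_forall_gt_imp_ge_of_dense fun c hc => ?_
      have hcont : Filter.Tendsto (fun η : ℝ => ENNReal.ofReal (t - (lastEnd e (s x) - η)))
          (nhdsWithin 0 (Ioi 0)) (nhds (ENNReal.ofReal (t - lastEnd e (s x)))) := by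
        refine Filter.Tendsto.mono_left ?_ nhdsWithin_le_nhds
        have : Continuous fun η : ℝ => ENNReal.ofReal (t - (lastEnd e (s x) - η)) :=
          ENNReal.continuous_ofReal.comp (by fun_prop)
        simpa using this.tendsto 0
      obtain ⟨η, hη, hη0⟩ :=
        ((hcont.eventually_lt_const hc).and self_mem_nhdsWithin).exists
      obtain ⟨_, ⟨y, rfl, hy⟩, hlt⟩ := exists_lt_of_lt_csSup (h.ends_nonempty x)
        (sub_lt_self (lastEnd e (s x)) hη0)
      exact (iInf₂_le y ((hiff y).2 hy)).trans
        ((ENNReal.ofReal_le_ofReal (by linarith)).trans hη.le)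
    · exact le_iInf₂ fun y hy =>
        ENNReal.ofReal_le_ofReal (by linarith [le_lastEnd ((hiff y).1 hy)])
  · intro y hy
    by_cases hty : t < s y
    · rw [indicator_of_mem (by exact hty)]
      have hlt : s x < s y := lt_of_le_of_ne (hmin y hty) fun h1 => hy (h.start_injective h1).symm
      have h1 := le_lastEnd (h.end_le_start hlt)
      have : gap s e y ∩ Iic t = ∅ := by
        ext u
        simp only [gap, mem_inter_iff, mem_Ico, mem_Iic, mem_empty_iff_false, iff_false]
        rintro ⟨⟨h2, _⟩, h3⟩
        linarith [h.start_lt x]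
      rw [this, measure_empty]
    · rw [indicator_of_notMem (by exact hty)]

theorem volume_inter_iUnion (h : SeparatedIntervals s e δ) {I : ι → Set ℝ}
    (hI : ∀ x, MeasurableSet (I x)) (hsub : ∀ x, I x ⊆ Ico (s x) (e x)) {A : Set ℝ}
    (hA : MeasurableSet A) : volume (A ∩ ⋃ x, I x) = ∑' x, volume (I x ∩ A) := by
  have := h.countable
  rw [inter_comm, iUnion_inter, measure_iUnion _ fun x => (hI x).inter hA]
  exact fun x y hxy => ((h.pairwise_disjoint hxy).mono (hsub x) (hsub y)).mono
    inter_subset_left inter_subset_left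

/-- Gap by gap, the part before `b` is the part before `a` plus the part in `(a, b]`. Gaps completed
in `(a, b]` count in full; the one still open at an endpoint is recorded by `age`. -/
theorem tsum_gap_add_age (h : SeparatedIntervals s e δ) {a b : ℝ} (hab : a ≤ b) :
    ∑' x, {x | s x ∈ Ioc a b}.indicator
        (fun x => ENNReal.ofReal (s x - lastEnd e (s x))) x + age s e b
      = volume (Ioc a b \ ⋃ x, Ico (s x) (e x)) + age s e a := by
  have := h.countable
  have hmeas : ∀ x, MeasurableSet (gap s e x) := fun x => measurableSet_Ico
  have hW : volume (Ioc a b \ ⋃ x, Ico (s x) (e x)) = ∑' x, volume (gap s e x ∩ Ioc a b) := by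
    rw [sdiff_eq, ← h.iUnion_gap, inter_comm, iUnion_inter,
      measure_iUnion _ fun x => (hmeas x).inter measurableSet_Ioc]
    exact fun x y hxy => (h.gap_pairwise_disjoint hxy).mono inter_subset_left inter_subset_left
  rw [hW, h.age_eq_tsum, h.age_eq_tsum, ← ENNReal.tsum_add, ← ENNReal.tsum_add]
  congr 1 with x
  by_cases h1 : s x ≤ a
  · have hE : gap s e x ∩ Ioc a b = ∅ := by
      ext u
      simp only [gap, mem_inter_iff, mem_Ico, mem_Ioc, mem_empty_iff_false, iff_false]
      rintro ⟨⟨_, h2⟩, h3, _⟩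
      linarith
    rw [indicator_of_notMem (s := {x | s x ∈ Ioc a b}) fun h2 => by linarith [h2.1],
      indicator_of_notMem (s := {x | b < s x}) fun h2 => (h1.trans hab).not_gt h2,
      indicator_of_notMem (s := {x | a < s x}) fun h2 => h1.not_gt h2, hE, measure_empty]
  · have h1' : a < s x := not_le.1 h1
    have hsplit : volume (gap s e x ∩ Ioc a b) + volume (gap s e x ∩ Iic a)
        = volume (gap s e x ∩ Iic b) := by
      rw [← measure_union _ ((hmeas x).inter measurableSet_Iic), ← inter_union_distrib_left,
        union_comm, Iic_union_Ioc_eq_Iic hab]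
      exact ((Iic_disjoint_Ioc le_rfl).mono inter_subset_right inter_subset_right).symm
    rw [indicator_of_mem (show x ∈ {x | a < s x} from h1'), hsplit]
    by_cases h2 : s x ≤ b
    · rw [indicator_of_mem (show x ∈ {x | s x ∈ Ioc a b} from ⟨h1', h2⟩),
        indicator_of_notMem (s := {x | b < s x}) fun h3 => h2.not_gt h3, add_zero,
        inter_eq_left.2 (show gap s e x ⊆ Iic b from fun u hu => hu.2.le.trans h2), gap, Real.volume_Ico]
    · rw [indicator_of_notMem (s := {x | s x ∈ Ioc a b}) fun h3 => h2 h3.2,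
        indicator_of_mem (show x ∈ {x | b < s x} from not_le.1 h2), zero_add]

end SeparatedIntervals

/-! ### Coboundaries of non-integrable functions -/

/-- A coboundary `X ∘ T - X` that is the difference of two nonnegative functions, one of which
has a finite integral, has mean zero, even if `X` is not integrable. -/
theorem MeasureTheory.MeasurePreserving.lintegral_eq_of_add_comp_eq_add {Ω : Type*}
    [MeasurableSpace Ω] {μ : Measure Ω} [IsProbabilityMeasure μ] {T : Ω → Ω}
    (hT : MeasurePreserving T μ μ) {V W X : Ω → ℝ≥0∞} (hX : AEMeasurable X μ)
    (hX_top : ∀ᵐ ω ∂μ, X ω ≠ ∞) (h : ∀ᵐ ω ∂μ, V ω + X (T ω) = W ω + X ω)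
    (hW : ∫⁻ ω, W ω ∂μ ≠ ∞) : ∫⁻ ω, V ω ∂μ = ∫⁻ ω, W ω ∂μ := by
  have hXT : AEMeasurable (fun ω => X (T ω)) μ := hX.comp_quasiMeasurePreserving
    hT.quasiMeasurePreserving
  have hXT_top : ∀ᵐ ω ∂μ, X (T ω) ≠ ∞ := hT.quasiMeasurePreserving.ae hX_top
  have hlim : ∀ A B : Ω → ℝ≥0∞, AEMeasurable A μ → AEMeasurable B μ →
      (∀ᵐ ω ∂μ, A ω ≠ ∞) → (∀ᵐ ω ∂μ, B ω ≠ ∞) →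
      Filter.Tendsto (fun n : ℕ => ∫⁻ ω, (min (A ω) n - min (B ω) n) ∂μ) Filter.atTop
        (nhds (∫⁻ ω, (A ω - B ω) ∂μ)) := by
    intro A B hA hB hA_top hB_top
    refine lintegral_tendsto_of_tendsto_of_monotone
      (fun n => (hA.min aemeasurable_const).sub (hB.min aemeasurable_const)) ?_ ?_
    · refine Filter.Eventually.of_forall fun ω m n hmn => ?_
      have hmn' : (m : ℝ≥0∞) ≤ n := by exact_mod_cast hmn
      rcases le_total (B ω) m with hB' | hB'
      · simp only [min_eq_left hB', min_eq_left (hB'.trans hmn')]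
        gcongr
      · simp only [min_eq_right hB']
        rw [tsub_eq_zero_of_le (min_le_right _ _)]
        exact zero_le
    · filter_upwards [hA_top, hB_top] with ω hA' hB'
      obtain ⟨a, ha⟩ := ENNReal.exists_nat_gt hA'
      obtain ⟨b, hb⟩ := ENNReal.exists_nat_gt hB'
      refine tendsto_const_nhds.congr' ?_
      filter_upwards [Filter.eventually_ge_atTop a, Filter.eventually_ge_atTop b] with n hna hnb
      rw [min_eq_left (ha.le.trans (by exact_mod_cast hna)),
        min_eq_left (hb.le.trans (by exact_mod_cast hnb))]
  -- The two parts of `X ∘ T - X` have equal integrals: this holds for the integrable truncations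
  -- `min X n`, by invariance, and passes to the limit monotonically.
  have hPQ : ∫⁻ ω, (X (T ω) - X ω) ∂μ = ∫⁻ ω, (X ω - X (T ω)) ∂μ := by
    refine tendsto_nhds_unique (hlim _ _ hXT hX hXT_top hX_top)
      ((hlim _ _ hX hXT hX_top hXT_top).congr fun n => ?_)
    have hfin : ∫⁻ ω, min (X ω) n ∂μ ≠ ∞ :=
      ne_top_of_le_ne_top (b := (n : ℝ≥0∞)) (ENNReal.natCast_ne_top n)
        ((lintegral_mono fun ω => min_le_right _ _).trans (by simp))
    have hinv : ∫⁻ ω, min (X (T ω)) n ∂μ = ∫⁻ ω, min (X ω) n ∂μ := by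
      have hm : AEMeasurable (fun ω => min (X ω) n) (Measure.map T μ) := by
        rw [hT.map_eq]; exact hX.min aemeasurable_const
      have := lintegral_map' hm hT.aemeasurable
      rw [hT.map_eq] at this
      exact this.symm
    have hsum : ∫⁻ ω, (min (X (T ω)) n + (min (X ω) n - min (X (T ω)) n)) ∂μ
        = ∫⁻ ω, (min (X ω) n + (min (X (T ω)) n - min (X ω) n)) ∂μ := by
      congr 1 with ω
      rw [add_tsub_eq_max, add_tsub_eq_max, max_comm]
    rw [lintegral_add_left' (hXT.min aemeasurable_const),
      lintegral_add_left' (hX.min aemeasurable_const), hinv] at hsum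
    exact (ENNReal.add_right_inj hfin).1 hsum
  -- The positive part is dominated by `W`, so its integral is finite and can be cancelled at the
  -- end.
  have hle : ∫⁻ ω, (X (T ω) - X ω) ∂μ ≤ ∫⁻ ω, W ω ∂μ := by
    refine lintegral_mono_ae ?_
    filter_upwards [h] with ω hω
    exact tsub_le_iff_right.2 (hω ▸ le_add_self)
  -- Cancelling `min X (X ∘ T)` pointwise leaves only the measurable positive and negative parts
  -- beside `V` and `W`, which themselves need no measurability.
  have hVW : ∫⁻ ω, (V ω + (X (T ω) - X ω)) ∂μ = ∫⁻ ω, (W ω + (X ω - X (T ω))) ∂μ := by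
    refine lintegral_congr_ae ?_
    filter_upwards [h, hX_top, hXT_top] with ω hω h1 h2
    have h3 : min (X ω) (X (T ω)) ≠ ∞ := ne_top_of_le_ne_top h1 (min_le_left _ _)
    rw [← ENNReal.add_left_inj h3]
    rcases le_total (X ω) (X (T ω)) with h4 | h4
    · rw [min_eq_left h4, tsub_eq_zero_of_le h4, add_zero, add_assoc, tsub_add_cancel_of_le h4, hω]
    · rw [min_eq_right h4, tsub_eq_zero_of_le h4, add_zero, add_assoc,
        tsub_add_cancel_of_le h4, hω]
  have hP : AEMeasurable (fun ω => X (T ω) - X ω) μ := hXT.sub hX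
  have hQ : AEMeasurable (fun ω => X ω - X (T ω)) μ := hX.sub hXT
  rw [lintegral_add_right' _ hP, lintegral_add_right' _ hQ, ← hPQ] at hVW
  exact (ENNReal.add_left_inj (ne_top_of_le_ne_top hW hle)).1 hVW

theorem volume_Ico_inter_Ioc (a b c d : ℝ) :
    volume (Ico a b ∩ Ioc c d) = ENNReal.ofReal (min b d - max a c) := by
  rw [measure_congr ((Ico_ae_eq_Ioc (a := a) (b := b)).inter (ae_eq_refl (Ioc c d))),
    Ioc_inter_Ioc, Real.volume_Ioc]

/-! ### The measurable space of visits -/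

namespace PON

variable {N L : ℕ} {P : PON N L} {i : Fin N}

namespace Visit

instance : MeasurableSpace (P.Visit i) :=
  MeasurableSpace.comap (fun v => (v.start, v.grant)) inferInstance

theorem measurable_start_grant :
    Measurable fun v : P.Visit i => (v.start, v.grant) :=
  comap_measurable _

theorem measurable_start : Measurable (Visit.start : P.Visit i → ℝ) :=
  measurable_start_grant.fst

theorem measurable_grant (j : Fin (P.numQueues i)) : Measurable fun v : P.Visit i => v.grant j :=
  (measurable_pi_apply j).comp measurable_start_grant.snd

theorem measurable_turn (j : Fin (P.numQueues i)) : Measurable fun v : P.Visit i => v.turn j :=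
  measurable_start.add (Finset.measurable_sum _ fun k _ => measurable_grant k)

theorem measurable_finish : Measurable (Visit.finish : P.Visit i → ℝ) :=
  (measurable_start.add (Finset.measurable_sum _ fun k _ => measurable_grant k)).add_const _

theorem start_delay (t : ℝ) (v : P.Visit i) : (v.delay t).start = v.start + t := rfl

theorem turn_delay (t : ℝ) (v : P.Visit i) (j : Fin (P.numQueues i)) :
    (v.delay t).turn j = v.turn j + t := by
  simp only [turn, delay]; ring

theorem finish_delay (t : ℝ) (v : P.Visit i) : (v.delay t).finish = v.finish + t := by
  simp only [finish, delay]; ring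

theorem delay_delay (s t : ℝ) (v : P.Visit i) : (v.delay s).delay t = v.delay (s + t) := by
  simp only [delay, add_assoc]

theorem delay_zero (v : P.Visit i) : v.delay 0 = v := by
  simp only [delay, add_zero]

/-- Delaying by `t`, as a bijection. -/
def delayEquiv (t : ℝ) : P.Visit i ≃ P.Visit i where
  toFun := delay t
  invFun := delay (-t)
  left_inv v := by rw [delay_delay, add_neg_cancel, delay_zero]
  right_inv v := by rw [delay_delay, neg_add_cancel, delay_zero]

/-- The sets of visits specified by intervals for the start and events for the grants. -/
def boxes (P : PON N L) (i : Fin N) : Set (Set (P.Visit i)) :=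
  {S | ∃ a b, ∃ G : Set (Fin (P.numQueues i) → ℝ), MeasurableSet G ∧
    S = {v | v.start ∈ Ioc a b ∧ v.grant ∈ G}}

theorem isPiSystem_boxes : IsPiSystem (boxes P i) := by
  rintro _ ⟨a, b, G, hG, rfl⟩ _ ⟨a', b', G', hG', rfl⟩ _
  refine ⟨max a a', min b b', G ∩ G', hG.inter hG', ?_⟩
  ext v
  simp only [← Ioc_inter_Ioc, mem_inter_iff, mem_ofPred_eq]
  tauto

/-- `visits_measurable` speaks only of these boxes; a π-λ argument extends it to all events. -/
theorem generateFrom_boxes :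
    (inferInstance : MeasurableSpace (P.Visit i)) = MeasurableSpace.generateFrom (boxes P i) := by
  apply le_antisymm
  · have h1 : Measurable[MeasurableSpace.generateFrom (boxes P i)] Visit.start := by
      rw [BorelSpace.measurable_eq (α := ℝ), borel_eq_generateFrom_Ioc ℝ]
      refine @measurable_generateFrom _ _ (_) _ _ ?_
      rintro _ ⟨a, b, -, rfl⟩
      exact MeasurableSpace.measurableSet_generateFrom
        ⟨a, b, univ, MeasurableSet.univ, by simp only [mem_univ, and_true]; rfl⟩
    have h2 : Measurable[MeasurableSpace.generateFrom (boxes P i)] Visit.grant := by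
      intro G hG
      have : (fun v : P.Visit i => v.grant) ⁻¹' G
          = ⋃ n : ℤ, {v | v.start ∈ Ioc (n : ℝ) (n + 1) ∧ v.grant ∈ G} := by
        ext v
        have := iUnion_Ioc_intCast ℝ ▸ mem_univ v.start
        simp only [mem_iUnion] at this
        simp only [mem_preimage, mem_iUnion, mem_ofPred_eq, exists_and_right, this, true_and]
      rw [this]
      exact MeasurableSet.iUnion fun n =>
        MeasurableSpace.measurableSet_generateFrom ⟨n, n + 1, G, hG, rfl⟩
    exact (h1.prodMk h2).comap_le
  · refine MeasurableSpace.generateFrom_le ?_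
    rintro _ ⟨a, b, G, hG, rfl⟩
    exact (measurable_start measurableSet_Ioc).inter (measurable_start_grant.snd hG)

end Visit

theorem Visit.start_add_overhead_le_finish {v : P.Visit i} (h : ∀ j, 0 ≤ v.grant j) :
    v.start + P.overhead i ≤ v.finish := by
  have := Finset.sum_nonneg fun j (_ : j ∈ Finset.univ) => h j
  simp only [Visit.finish]
  linarith

end PON

/-! ### Geometry of a single trajectory -/

namespace PON

variable {N L : ℕ} {P : PON N L} {i : Fin N} {visits : Fin L → (i : Fin N) → Set (P.Visit i)}
  {arrived : (i : Fin N) → Fin (P.numQueues i) → Measure ℝ}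
  {backlog : (i : Fin N) → Fin (P.numQueues i) → ℝ → ℝ}

namespace IsTrajectory

theorem start_add_overhead_le (h : P.IsTrajectory visits arrived backlog) {l : Fin L}
    {v : P.Visit i} (hv : v ∈ visits l i) : v.start + P.overhead i ≤ v.finish :=
  Visit.start_add_overhead_le_finish (h.grant_nonneg l i v hv)

theorem start_mem_period (h : P.IsTrajectory visits arrived backlog) {l : Fin L}
    {v : P.Visit i} (hv : v ∈ visits l i) : v.start ∈ v.period :=
  ⟨le_rfl, by linarith [h.start_add_overhead_le hv, P.overhead_pos i]⟩

theorem eq_of_mem_period (h : P.IsTrajectory visits arrived backlog) {l l' : Fin L}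
    {u v : P.Visit i} (hu : u ∈ visits l i) (hv : v ∈ visits l' i) {t : ℝ} (htu : t ∈ u.period)
    (htv : t ∈ v.period) : l = l' ∧ u = v :=
  Prod.mk.inj (h.one_transmitter i t (x := (l, u)) ⟨hu, htu⟩ (y := (l', v)) ⟨hv, htv⟩)

/-- The periods in which some wavelength is present at ONU `i`. -/
theorem separatedIntervals (h : P.IsTrajectory visits arrived backlog) (i : Fin N) :
    SeparatedIntervals (fun x : Σ l, visits l i => x.2.1.start) (fun x => x.2.1.finish)
      (P.overhead i) where
  pos := P.overhead_pos i
  length x := h.start_add_overhead_le x.2.2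
  disjoint := by
    rintro ⟨l, u, hu⟩ ⟨l', v, hv⟩ t htu htv
    obtain ⟨rfl, rfl⟩ := h.eq_of_mem_period hu hv htu htv
    rfl
  after t := by
    obtain ⟨l, v, hv, ht⟩ := h.visited_after i t
    exact ⟨⟨l, v, hv⟩, ht⟩
  before t := by
    obtain ⟨l, v, hv, ht⟩ := h.visited_before i t
    exact ⟨⟨l, v, hv⟩, ht⟩

/-- A visit lasts at least the overhead, so a second one starting in the same short window would
overlap it. -/
theorem eq_of_start_mem_Ioc (h : P.IsTrajectory visits arrived backlog) {l : Fin L}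
    {u v : P.Visit i} (hu : u ∈ visits l i) (hv : v ∈ visits l i) {a b : ℝ}
    (hab : b ≤ a + P.overhead i) (hua : u.start ∈ Ioc a b) (hva : v.start ∈ Ioc a b) :
    u = v := by
  rcases le_total u.start v.start with h1 | h1
  · exact (h.eq_of_mem_period hu hv ⟨h1, by linarith [h.start_add_overhead_le hu, hva.2, hua.1]⟩
      (h.start_mem_period hv)).2
  · exact (h.eq_of_mem_period hu hv (h.start_mem_period hu)
      ⟨h1, by linarith [h.start_add_overhead_le hv, hua.2, hva.1]⟩).2

theorem transmission_subset (h : P.IsTrajectory visits arrived backlog) {l : Fin L}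
    {v : P.Visit i} (hv : v ∈ visits l i) (j : Fin (P.numQueues i)) :
    v.transmission j ⊆ v.period := by
  have hg := h.grant_nonneg l i v hv
  refine Ico_subset_Ico (le_add_of_nonneg_right (Finset.sum_nonneg fun k _ => hg k)) ?_
  have h1 : ∑ k ∈ Finset.Iio j, v.grant k + v.grant j = ∑ k ∈ Finset.Iic j, v.grant k := by
    rw [← Finset.Iio_insert, Finset.sum_insert (by simp), add_comm]
  have h2 := Finset.sum_le_sum_of_subset_of_nonneg (Finset.subset_univ (Finset.Iic j))
    fun k _ _ => hg k
  simp only [Visit.turn, Visit.finish]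
  linarith [P.overhead_pos i]

/-- Each wavelength is busy all the time. -/
theorem sum_tsum_period (h : P.IsTrajectory visits arrived backlog) (l : Fin L) :
    ∑ i, ∑' v : visits l i, volume (v.1.period ∩ Ioc 0 1) = 1 := by
  have (i : Fin N) : Countable (visits l i) :=
    have := (h.separatedIntervals i).countable
    (sigma_mk_injective (β := fun l => visits l i) (i := l)).countable
  have hunion : ⋃ x : Σ i, visits l i, x.2.1.period ∩ Ioc (0 : ℝ) 1 = Ioc 0 1 := by
    rw [← iUnion_inter, inter_eq_right]
    intro t _
    obtain ⟨⟨i, v⟩, ⟨hv, ht⟩, -⟩ := h.wavelength_busy l t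
    exact mem_iUnion.2 ⟨⟨i, v, hv⟩, ht⟩
  have hmeas (x : Σ i, visits l i) : MeasurableSet (x.2.1.period ∩ Ioc (0 : ℝ) 1) :=
    measurableSet_Ico.inter measurableSet_Ioc
  rw [← tsum_fintype (L := SummationFilter.unconditional _), ← ENNReal.tsum_sigma'
    (fun x : Σ i, visits l i => volume (x.2.1.period ∩ Ioc 0 1)),
    ← measure_iUnion _ hmeas, hunion]
  · simp
  · rintro ⟨i, u, hu⟩ ⟨i', v, hv⟩ hne
    refine Set.disjoint_left.2 fun t htu htv => hne ?_
    have := (h.wavelength_busy l t).unique (y₁ := ⟨i, u⟩) (y₂ := ⟨i', v⟩)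
      ⟨hu, htu.1⟩ ⟨hv, htv.1⟩
    obtain ⟨rfl, h2⟩ := Sigma.mk.inj_iff.1 this
    obtain rfl := eq_of_heq h2
    rfl

end IsTrajectory

/-! ### Sums over visits: measurability, stationarity, mass transport -/

namespace Equilibrium

variable {Ω : Type*} [MeasurableSpace Ω] {μ : Measure Ω} (E : P.Equilibrium μ)

/-- The sum of the values `g v` over all visits `v` of wavelength `l` to ONU `i`. -/
noncomputable def pointSum (l : Fin L) (i : Fin N) (g : P.Visit i → ℝ≥0∞) (ω : Ω) : ℝ≥0∞ :=
  ∑' v : E.visits ω l i, g v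

/-- The counting measure of the visits of wavelength `l` to ONU `i`. -/
noncomputable def visitMeasure (l : Fin L) (i : Fin N) (ω : Ω) : Measure (P.Visit i) :=
  Measure.sum fun v : E.visits ω l i => Measure.dirac v.1

theorem lintegral_visitMeasure (l : Fin L) {g : P.Visit i → ℝ≥0∞} (hg : Measurable g) (ω : Ω) :
    ∫⁻ v, g v ∂E.visitMeasure l i ω = E.pointSum l i g ω := by
  simp_rw [visitMeasure, lintegral_sum_measure, lintegral_dirac' _ hg, pointSum]

/-- With at most one start in the window, the count is the indicator of existence, which is the kind
of event assumed measurable. -/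
theorem visitMeasure_of_start_mem_Ioc {l : Fin L} {ω : Ω}
    (h : P.IsTrajectory (E.visits ω) arrived backlog) {S : Set (P.Visit i)}
    (hS : MeasurableSet S) {a b : ℝ} (hab : b ≤ a + P.overhead i) :
    E.visitMeasure l i ω (S ∩ {v | v.start ∈ Ioc a b})
      = {ω | ∃ v ∈ E.visits ω l i, v.start ∈ Ioc a b ∧ v ∈ S}.indicator 1 ω := by
  have hSm : MeasurableSet (S ∩ {v | v.start ∈ Ioc a b}) :=
    hS.inter (Visit.measurable_start measurableSet_Ioc)
  simp_rw [visitMeasure, Measure.sum_apply _ hSm, Measure.dirac_apply' _ hSm]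
  by_cases hex : ∃ v ∈ E.visits ω l i, v.start ∈ Ioc a b ∧ v ∈ S
  · obtain ⟨v, hv, hvs, hvS⟩ := hex
    rw [tsum_eq_single ⟨v, hv⟩, indicator_of_mem (show v ∈ S ∩ _ from ⟨hvS, hvs⟩),
      indicator_of_mem (by exact ⟨v, hv, hvs, hvS⟩)]
    · rfl
    · rintro ⟨u, hu⟩ hne
      exact indicator_of_notMem (fun h' => hne
        (Subtype.ext (h.eq_of_start_mem_Ioc hu hv hab h'.2 hvs))) _
  · rw [indicator_of_notMem (by exact hex), ENNReal.tsum_eq_zero]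
    rintro ⟨u, hu⟩
    exact indicator_of_notMem (fun h' => hex ⟨u, hu, h'.2, h'.1⟩) _

/-- The start axis is cut into windows of length `Δ_i`. In each the counting measure is 0 or 1 on
every event, hence a finite kernel whose measurability can be tested on boxes. -/
theorem aemeasurable_pointSum (l : Fin L) {g : P.Visit i → ℝ≥0∞} (hg : Measurable g) :
    AEMeasurable (E.pointSum l i g) μ := by
  classical
  obtain ⟨G, hGae, hGm, hG⟩ := E.isTrajectory.exists_measurable_mem
  set δ := P.overhead i
  have hδ : 0 < δ := P.overhead_pos i
  let J : ℤ → Set (P.Visit i) := fun k => {v | v.start ∈ Ioc (k • δ) ((k + 1) • δ)}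
  have hJ : ∀ k, MeasurableSet (J k) := fun k => Visit.measurable_start measurableSet_Ioc
  have hlen : ∀ k : ℤ, (k + 1) • δ ≤ k • δ + δ := fun k => by rw [add_smul, one_smul]
  -- The trajectory axioms hold only almost surely; the kernel is set to 0 off a measurable set
  -- where they hold.
  let ν : ℤ → Ω → Measure (P.Visit i) := fun k ω =>
    if ω ∈ G then (E.visitMeasure l i ω).restrict (J k) else 0
  have hν : ∀ k S, MeasurableSet S → ∀ ω, ν k ω S
      = (G ∩ {ω | ∃ v ∈ E.visits ω l i, v.start ∈ Ioc (k • δ) ((k + 1) • δ) ∧ v ∈ S}).indicator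
        1 ω := by
    intro k S hS ω
    by_cases hω : ω ∈ G
    · simp only [ν, if_pos hω]
      rw [Measure.restrict_apply hS, E.visitMeasure_of_start_mem_Ioc (hG ω hω) hS (hlen k),
        inter_comm, ← indicator_indicator]
      simp only [indicator, hω, if_true]
    · simp only [ν, if_neg hω]
      rw [indicator_of_notMem fun h => hω h.1]
      rfl
  have hfin : ∀ k ω, IsFiniteMeasure (ν k ω) := fun k ω => ⟨by
    rw [hν k _ MeasurableSet.univ ω]
    exact (indicator_le_self' (fun _ _ => zero_le) ω).trans_lt (by simp)⟩
  have hνm : ∀ k, Measurable (ν k) := by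
    intro k
    refine Measurable.measure_of_isPiSystem Visit.generateFrom_boxes Visit.isPiSystem_boxes ?_ ?_
    · rintro _ ⟨a, b, A, hA, rfl⟩
      have hS : MeasurableSet {v : P.Visit i | v.start ∈ Ioc a b ∧ v.grant ∈ A} :=
        (Visit.measurable_start measurableSet_Ioc).inter
          (Visit.measurable_start_grant.snd hA)
      simp_rw [hν k _ hS]
      refine measurable_one.indicator (hGm.inter ?_)
      convert E.visits_measurable l i (max (k • δ) a) (min ((k + 1) • δ) b) A hA using 5 with ω v
      simp only [← Ioc_inter_Ioc, mem_inter_iff, mem_ofPred_eq, and_assoc]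
    · simp_rw [hν k _ MeasurableSet.univ]
      refine measurable_one.indicator (hGm.inter ?_)
      exact E.visits_measurable l i (k • δ) ((k + 1) • δ) univ MeasurableSet.univ
  refine ⟨fun ω => ∑' k, ∫⁻ v, g v ∂ν k ω, Measurable.tsum
    fun k => (Measure.measurable_lintegral hg).comp (hνm k), ?_⟩
  filter_upwards [hGae] with ω hω
  have hJU : ⋃ k, J k = univ := by
    have := iUnion_Ioc_zsmul hδ
    ext v
    simpa [J] using (this ▸ mem_univ v.start : v.start ∈ ⋃ n : ℤ, Ioc (n • δ) ((n + 1) • δ))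
  have hJd : Pairwise (Function.onFun Disjoint J) := fun a b hab =>
    (pairwise_disjoint_Ioc_zsmul δ hab).preimage Visit.start
  simp only [ν, if_pos hω]
  rw [← lintegral_iUnion hJ hJd, hJU, Measure.restrict_univ, E.lintegral_visitMeasure l hg]

theorem pointSum_flow (l : Fin L) (g : P.Visit i → ℝ≥0∞) (t : ℝ) (ω : Ω) :
    E.pointSum l i g (E.flow t ω) = E.pointSum l i (fun v => g (v.delay (-t))) ω := by
  have hv : ∀ v, v ∈ E.visits (E.flow t ω) l i ↔ v.delay t ∈ E.visits ω l i := fun v => by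
    rw [E.visits_flow]; rfl
  simp only [pointSum]
  rw [← ((Visit.delayEquiv (P := P) (i := i) t).subtypeEquiv hv).tsum_eq
    (fun v : E.visits ω l i => g (v.1.delay (-t)))]
  refine tsum_congr fun v => ?_
  exact congrArg g ((Visit.delayEquiv t).left_inv v.1).symm

/-- Delaying all visits by `t` amounts to applying the measure preserving `flow (-t)`. -/
theorem lintegral_pointSum_delay (l : Fin L) {g : P.Visit i → ℝ≥0∞} (hg : Measurable g) (t : ℝ) :
    ∫⁻ ω, E.pointSum l i (fun v => g (v.delay t)) ω ∂μ = ∫⁻ ω, E.pointSum l i g ω ∂μ := by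
  have hT := E.flow_preserving (-t)
  have hm : AEMeasurable (E.pointSum l i g) (Measure.map (E.flow (-t)) μ) := by
    rw [hT.map_eq]; exact E.aemeasurable_pointSum l hg
  have := lintegral_map' hm hT.aemeasurable
  rw [hT.map_eq] at this
  rw [this]
  simp only [E.pointSum_flow, neg_neg]

theorem lintegral_pointSum_tsum (l : Fin L) {κ : Type*} [Countable κ]
    {g : κ → P.Visit i → ℝ≥0∞} (hg : ∀ k, Measurable (g k)) :
    ∫⁻ ω, E.pointSum l i (fun v => ∑' k, g k v) ω ∂μ
      = ∑' k, ∫⁻ ω, E.pointSum l i (g k) ω ∂μ := by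
  rw [← lintegral_tsum fun k => E.aemeasurable_pointSum l (hg k)]
  congr 1 with ω
  exact ENNReal.tsum_comm

/-- Mass transport: the mean length of an interval attached to the visits that start in a unit
of time is the mean time covered by the intervals in a unit of time. -/
theorem lintegral_pointSum_length (l : Fin L) {a b : P.Visit i → ℝ} (ha : Measurable a)
    (hb : Measurable b) (ha' : ∀ t v, a (v.delay t) = a v + t)
    (hb' : ∀ t v, b (v.delay t) = b v + t) :
    ∫⁻ ω, E.pointSum l i
        ({v | v.start ∈ Ioc 0 1}.indicator fun v => ENNReal.ofReal (b v - a v)) ω ∂μ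
      = ∫⁻ ω, E.pointSum l i (fun v => volume (Ico (a v) (b v) ∩ Ioc 0 1)) ω ∂μ := by
  have hstart : ∀ c d : ℝ, MeasurableSet {v : P.Visit i | v.start ∈ Ioc c d} := fun c d =>
    Visit.measurable_start measurableSet_Ioc
  have hvol : ∀ c d : ℝ, Measurable fun v => volume (Ico (a v) (b v) ∩ Ioc c d) := fun c d => by
    simp_rw [volume_Ico_inter_Ioc]
    exact ((hb.min measurable_const).sub (ha.max measurable_const)).ennreal_ofReal
  -- The left side is split by the unit cell in which the interval's length lies, the right side
  -- (`h2`) by the cell of the start. Delaying by `n` matches the `n`th terms.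
  have h1 : {v : P.Visit i | v.start ∈ Ioc 0 1}.indicator (fun v => ENNReal.ofReal (b v - a v))
        = fun v => ∑' n : ℤ, {v : P.Visit i | v.start ∈ Ioc 0 1}.indicator
          (fun v => volume (Ico (a v) (b v) ∩ Ioc (n : ℝ) (n + 1))) v := by
    ext v
    by_cases hv : v ∈ {v : P.Visit i | v.start ∈ Ioc 0 1}
    · simp only [indicator_of_mem hv]
      rw [← measure_iUnion _ fun n => measurableSet_Ico.inter measurableSet_Ioc,
        ← inter_iUnion, iUnion_Ioc_intCast, inter_univ, Real.volume_Ico]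
      exact fun m n hmn => (pairwise_disjoint_Ioc_intCast ℝ hmn).mono
        inter_subset_right inter_subset_right
    · simp only [indicator_of_notMem hv, tsum_zero]
  have h2 : (fun v : P.Visit i => volume (Ico (a v) (b v) ∩ Ioc 0 1))
      = fun v => ∑' n : ℤ, {v : P.Visit i | v.start ∈ Ioc (-n : ℝ) (-n + 1)}.indicator
          (fun v => volume (Ico (a v) (b v) ∩ Ioc 0 1)) v := by
    ext v
    have hmem : ∀ n : ℤ, v.start ∈ Ioc (-n : ℝ) (-n + 1) ↔ n = 1 - ⌈v.start⌉ := fun n => by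
      have := Int.ceil_eq_iff (a := v.start) (z := 1 - n)
      push_cast at this
      rw [mem_Ioc, show n = 1 - ⌈v.start⌉ ↔ ⌈v.start⌉ = 1 - n by omega, this]
      constructor <;> rintro ⟨h1, h2⟩ <;> constructor <;> linarith
    rw [tsum_eq_single (1 - ⌈v.start⌉), indicator_of_mem (by exact (hmem _).2 rfl)]
    exact fun n hn => indicator_of_notMem
      (s := {v : P.Visit i | v.start ∈ Ioc (-n : ℝ) (-n + 1)}) (fun h => hn ((hmem n).1 h)) _
  rw [h1, h2, E.lintegral_pointSum_tsum l fun n => (hvol _ _).indicator (hstart _ _),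
    E.lintegral_pointSum_tsum l fun n => (hvol _ _).indicator (hstart _ _)]
  refine tsum_congr fun n => ?_
  rw [← E.lintegral_pointSum_delay l ((hvol _ _).indicator (hstart _ _)) n]
  refine lintegral_congr fun ω => tsum_congr fun v => ?_
  have h3 : min (b v + n) (n + 1 : ℝ) = min (b v) 1 + n := by
    rw [add_comm (n : ℝ) 1, min_add_add_right]
  have h4 : max (a v + n) (n : ℝ) = max (a v) 0 + n := by rw [← max_add_add_right, zero_add]
  have h5 : v.1.start + n ∈ Ioc (0 : ℝ) 1 ↔ v.1.start ∈ Ioc (-n : ℝ) (-n + 1) := by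
    constructor <;> rintro ⟨h1, h2⟩ <;> constructor <;> linarith
  simp only [indicator, mem_ofPred_eq, Visit.start_delay, ha', hb', volume_Ico_inter_Ioc, h3, h4,
    h5, add_sub_add_right_eq_sub]

end Equilibrium
end PON

theorem ENNReal.tsum_subtype_and {α : Type*} (A : Set α) (p : α → Prop) (F : α → ℝ≥0∞) :
    ∑' v : {v // v ∈ A ∧ p v}, F v = ∑' v : A, {v | p v}.indicator F v := by
  rw [tsum_subtype A, indicator_indicator]
  exact tsum_subtype (A ∩ {v | p v}) F

namespace PON

variable {N L : ℕ} {P : PON N L} {i : Fin N}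

namespace Equilibrium

variable {Ω : Type*} [MeasurableSpace Ω] {μ : Measure Ω} (E : P.Equilibrium μ)

theorem measurable_indicator_start {f : P.Visit i → ℝ≥0∞} (hf : Measurable f) (a b : ℝ) :
    Measurable ({v : P.Visit i | v.start ∈ Ioc a b}.indicator f) :=
  hf.indicator (Visit.measurable_start measurableSet_Ioc)

theorem visitSum_eq_sum_pointSum {f : P.Visit i → ℝ} (hf : Measurable f) :
    E.visitSum i (fun _ v => f v) = ∑ l, ∫⁻ ω, E.pointSum l i
      ({v | v.start ∈ Ioc 0 1}.indicator fun v => ENNReal.ofReal (f v)) ω ∂μ := by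
  rw [← lintegral_finsetSum' _ fun l _ => E.aemeasurable_pointSum l
    (measurable_indicator_start hf.ennreal_ofReal 0 1)]
  refine lintegral_congr fun ω => Finset.sum_congr rfl fun l _ => ?_
  exact ENNReal.tsum_subtype_and _ _ fun v => ENNReal.ofReal (f v)

/-- The infimum is that of the thresholds `c q` for which some visit has `g v < c q`; such a visit
exists exactly when a point sum is nonzero. -/
theorem aemeasurable_iInf_visits (l : Fin L) {g : P.Visit i → ℝ≥0∞} (hg : Measurable g) :
    AEMeasurable (fun ω => ⨅ v : E.visits ω l i, g v) μ := by
  classical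
  let c : ℚ → ℝ≥0∞ := fun q => (Real.toNNReal q : ℝ≥0∞)
  have hlt : ∀ q, MeasurableSet {v : P.Visit i | g v < c q} := fun q =>
    measurableSet_lt hg measurable_const
  have hrep : (fun ω => ⨅ v : E.visits ω l i, g v) = fun ω => ⨅ q,
      (fun s : ℝ≥0∞ => if s = 0 then ∞ else c q)
        (E.pointSum l i ({v | g v < c q}.indicator 1) ω) := by
    ext ω
    apply le_antisymm
    · refine le_iInf fun q => ?_
      by_cases h0 : E.pointSum l i ({v | g v < c q}.indicator 1) ω = 0
      · simp only [h0, if_true, le_top]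
      · simp only [h0, if_false]
        obtain ⟨v, hv⟩ : ∃ v : E.visits ω l i, {v | g v < c q}.indicator
            (1 : P.Visit i → ℝ≥0∞) v.1 ≠ 0 := by
          by_contra! hall
          exact h0 (ENNReal.tsum_eq_zero.2 hall)
        exact (iInf_le _ v).trans (mem_of_indicator_ne_zero hv).le
    · refine le_iInf fun v => le_of_forall_gt_imp_ge_of_dense fun a ha => ?_
      obtain ⟨q, -, h1, h2⟩ := ENNReal.lt_iff_exists_rat_btwn.1 ha
      have h0 : E.pointSum l i ({v | g v < c q}.indicator 1) ω ≠ 0 := fun h => by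
        have := ENNReal.tsum_eq_zero.1 h v
        rw [indicator_of_mem (by exact h1)] at this
        exact one_ne_zero this
      refine (iInf_le _ q).trans ?_
      simp only [h0, if_false]
      exact h2.le
  rw [hrep]
  have hite (q : ℚ) : Measurable fun s : ℝ≥0∞ => if s = 0 then ∞ else c q :=
    Measurable.ite (measurableSet_singleton 0) measurable_const measurable_const
  exact AEMeasurable.iInf fun q => (hite q).comp_aemeasurable
    (E.aemeasurable_pointSum l (measurable_one.indicator (hlt q)))

/-! ### Vacations in stationarity -/

/-- The time elapsed at `t` since the end of the last visit to ONU `i` that starts before `t`. -/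
noncomputable def vacationAge (i : Fin N) (t : ℝ) (ω : Ω) : ℝ≥0∞ :=
  SeparatedIntervals.age (fun x : Σ l, E.visits ω l i => x.2.1.start) (fun x => x.2.1.finish) t

theorem vacationAge_eq (i : Fin N) (t : ℝ) (ω : Ω) : E.vacationAge i t ω
    = ⨅ l, ⨅ v : E.visits ω l i, ⨅ _ : v.1.start ≤ t, ENNReal.ofReal (t - v.1.finish) := by
  rw [vacationAge, SeparatedIntervals.age, iInf_sigma]

theorem aemeasurable_vacationAge (i : Fin N) (t : ℝ) : AEMeasurable (E.vacationAge i t) μ := by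
  classical
  simp_rw [funext (E.vacationAge_eq i t), iInf_eq_if]
  refine AEMeasurable.iInf fun l => E.aemeasurable_iInf_visits l
    (g := fun v => if v.start ≤ t then ENNReal.ofReal (t - v.finish) else ⊤) ?_
  exact Measurable.ite (measurableSet_le Visit.measurable_start measurable_const)
    (Visit.measurable_finish.const_sub t).ennreal_ofReal measurable_const

theorem vacationAge_flow (i : Fin N) (s t : ℝ) (ω : Ω) :
    E.vacationAge i t (E.flow s ω) = E.vacationAge i (t + s) ω := by
  simp_rw [vacationAge_eq, iInf_subtype]
  refine iInf_congr fun l => (Visit.delayEquiv s).iInf_congr fun v => ?_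
  have hv : v ∈ E.visits (E.flow s ω) l i ↔ v.delay s ∈ E.visits ω l i := by
    rw [E.visits_flow]; rfl
  have h1 : (Visit.delayEquiv s v).start = v.start + s := rfl
  have h2 : (Visit.delayEquiv s v).finish = v.finish + s := v.finish_delay s
  rw [h1, h2]
  simp only [hv, add_le_add_iff_right, add_sub_add_right_eq_sub]
  rfl

/-- The mean total length of the vacations ending in a unit of time is the mean time that the ONU
is on vacation. -/
theorem visitSum_vacation [IsProbabilityMeasure μ] (i : Fin N) :
    E.visitSum i (fun ω v => E.vacation ω i v) = ∫⁻ ω, volume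
      (Ioc (0 : ℝ) 1 \ ⋃ x : Σ l, E.visits ω l i, x.2.1.period) ∂μ := by
  -- The coboundary is the age at time 1 minus the age at time 0; the idle time in the window is at
  -- most 1.
  refine (E.flow_preserving 1).lintegral_eq_of_add_comp_eq_add
    (E.aemeasurable_vacationAge i 0) ?_ ?_ ?_
  · filter_upwards [E.isTrajectory] with ω h
    exact (h.separatedIntervals i).age_ne_top 0
  · filter_upwards [E.isTrajectory] with ω h
    have := (h.separatedIntervals i).tsum_gap_add_age zero_le_one
    rw [E.vacationAge_flow, zero_add]
    refine Eq.trans (congrArg (· + _) ?_) this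
    rw [ENNReal.tsum_sigma', tsum_fintype]
    refine Finset.sum_congr rfl fun l _ => ?_
    rw [ENNReal.tsum_subtype_and _ (fun v => v.start ∈ Ioc (0 : ℝ) 1)
      fun v => ENNReal.ofReal (E.vacation ω i v)]
    refine tsum_congr fun v => ?_
    have hset : {a | ∃ y : Σ l, E.visits ω l i, a = y.2.1.finish ∧ a ≤ v.1.start}
        = {e | ∃ l, ∃ u ∈ E.visits ω l i, e = u.finish ∧ e ≤ v.1.start} := by
      ext a
      exact ⟨fun ⟨y, hy⟩ => ⟨y.1, y.2.1, y.2.2, hy⟩, fun ⟨l, u, hu, hy⟩ => ⟨⟨l, u, hu⟩, hy⟩⟩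
    simp only [indicator, mem_ofPred_eq, vacation, SeparatedIntervals.lastEnd, hset]
    congr
  · refine ne_top_of_le_ne_top (ENNReal.one_ne_top) ?_
    calc _ ≤ ∫⁻ _, 1 ∂μ := lintegral_mono fun ω =>
          (measure_mono sdiff_subset).trans (by simp)
      _ = 1 := by simp

/-! ### Balance of presence, work and overhead -/

/-- The mean time in a unit of time in which some wavelength is present at ONU `i`. -/
noncomputable def meanPresence (i : Fin N) : ℝ≥0∞ :=
  ∑ l, ∫⁻ ω, E.pointSum l i (fun v => volume (v.period ∩ Ioc 0 1)) ω ∂μ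

theorem measurable_volume_Ico_inter {a b : P.Visit i → ℝ} (ha : Measurable a)
    (hb : Measurable b) : Measurable fun v => volume (Ico (a v) (b v) ∩ Ioc 0 1) := by
  simp_rw [volume_Ico_inter_Ioc]
  exact ((hb.min measurable_const).sub (ha.max measurable_const)).ennreal_ofReal

theorem aemeasurable_pointSum_period (l : Fin L) (i : Fin N) :
    AEMeasurable (E.pointSum l i fun v => volume (v.period ∩ Ioc 0 1)) μ :=
  E.aemeasurable_pointSum l
    (measurable_volume_Ico_inter Visit.measurable_start Visit.measurable_finish)

theorem visitSum_vacation_add_meanPresence [IsProbabilityMeasure μ] (i : Fin N) :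
    E.visitSum i (fun ω v => E.vacation ω i v) + E.meanPresence i = 1 := by
  rw [visitSum_vacation, meanPresence,
    ← lintegral_finsetSum' _ fun l _ => E.aemeasurable_pointSum_period l i,
    ← lintegral_add_right' _ (Finset.aemeasurable_fun_sum _
      fun l _ => E.aemeasurable_pointSum_period l i)]
  have : ∀ᵐ ω ∂μ, volume (Ioc (0 : ℝ) 1 \ ⋃ x : Σ l, E.visits ω l i, x.2.1.period)
      + ∑ l, E.pointSum l i (fun v => volume (v.period ∩ Ioc 0 1)) ω = 1 := by
    filter_upwards [E.isTrajectory] with ω h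
    have hs := h.separatedIntervals i
    have := hs.countable
    have h1 := hs.volume_inter_iUnion (fun _ => measurableSet_Ico) (fun _ => subset_rfl)
      (measurableSet_Ioc (a := (0 : ℝ)) (b := 1))
    rw [ENNReal.tsum_sigma', tsum_fintype] at h1
    have h2 := measure_sdiff_add_inter (μ := volume) (Ioc (0 : ℝ) 1)
      (MeasurableSet.iUnion fun x : Σ l, E.visits ω l i =>
        (measurableSet_Ico : MeasurableSet x.2.1.period))
    rw [Real.volume_Ioc, sub_zero, ENNReal.ofReal_one] at h2
    rw [← h2]
    exact congrArg (_ + ·) h1.symm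
  rw [lintegral_congr_ae this]
  simp

theorem sum_meanPresence [IsProbabilityMeasure μ] : ∑ i, E.meanPresence i = L := by
  simp only [meanPresence]
  rw [Finset.sum_comm]
  have : ∀ l : Fin L,
      ∑ i, ∫⁻ ω, E.pointSum l i (fun v => volume (v.period ∩ Ioc 0 1)) ω ∂μ = 1 := fun l => by
    rw [← lintegral_finsetSum' _ fun i _ => E.aemeasurable_pointSum_period l i]
    have : ∀ᵐ ω ∂μ, ∑ i, E.pointSum l i (fun v => volume (v.period ∩ Ioc 0 1)) ω = 1 :=
      E.isTrajectory.mono fun ω h => h.sum_tsum_period l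
    rw [lintegral_congr_ae this]
    simp
  simp [this]

/-- The mean work transmitted from a queue in a unit of time equals the mean work arriving. -/
theorem lintegral_volume_transmitting [IsProbabilityMeasure μ] (i : Fin N)
    (j : Fin (P.numQueues i)) :
    ∫⁻ ω, volume (Ioc 0 1 ∩ P.transmitting (E.visits ω) i j) ∂μ
      = ∫⁻ ω, E.arrived ω i j (Ioc 0 1) ∂μ := by
  -- The backlog may have infinite mean; finiteness of the arrival rate suffices.
  refine (E.flow_preserving 1).lintegral_eq_of_add_comp_eq_add
    (X := fun ω => ENNReal.ofReal (E.backlog ω i j))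
    (E.backlog_measurable i j).ennreal_ofReal.aemeasurable
    (Filter.Eventually.of_forall fun _ => ENNReal.ofReal_ne_top) ?_ (E.rate_ne_top i j)
  filter_upwards [E.isTrajectory] with ω h
  have hb := h.backlog_balance i j 0 1 zero_le_one
  have h0 := h.backlog_nonneg i j 0
  have h1 := h.backlog_nonneg i j 1
  have hA := h.arrived_ne_top i j 0 1
  have hD : volume (Ioc 0 1 ∩ P.transmitting (E.visits ω) i j) ≠ ∞ :=
    measure_ne_top_of_subset inter_subset_left (by simp)
  rw [E.flow_zero] at hb h0
  rw [← ENNReal.ofReal_toReal hD, ← ENNReal.ofReal_toReal hA,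
    ← ENNReal.ofReal_add ENNReal.toReal_nonneg h1, ← ENNReal.ofReal_add ENNReal.toReal_nonneg h0]
  congr 1
  simp only [measureReal_def] at hb
  linarith

/-- The mean of the grants given to a queue in a unit of time is the mean work arriving. -/
theorem sum_lintegral_pointSum_grant [IsProbabilityMeasure μ] (i : Fin N)
    (j : Fin (P.numQueues i)) :
    ∑ l, ∫⁻ ω, E.pointSum l i
      ({v | v.start ∈ Ioc 0 1}.indicator fun v => ENNReal.ofReal (v.grant j)) ω ∂μ
      = ∫⁻ ω, E.arrived ω i j (Ioc 0 1) ∂μ := by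
  have hm : Measurable fun v : P.Visit i => v.turn j + v.grant j :=
    (Visit.measurable_turn j).add (Visit.measurable_grant j)
  have h1 : ∀ l, _ := fun l => E.lintegral_pointSum_length l (Visit.measurable_turn j) hm
    (fun t v => v.turn_delay t j) (fun t v => by
      rw [Visit.turn_delay, add_right_comm]; rfl)
  simp only [add_sub_cancel_left] at h1
  simp_rw [h1]
  rw [← E.lintegral_volume_transmitting, ← lintegral_finsetSum' _ fun l _ =>
    E.aemeasurable_pointSum l (measurable_volume_Ico_inter (Visit.measurable_turn j) hm)]
  refine lintegral_congr_ae ?_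
  filter_upwards [E.isTrajectory] with ω h
  -- Transmissions of different visits are disjoint because they lie inside disjoint presence
  -- periods.
  have h2 := (h.separatedIntervals i).volume_inter_iUnion (I := fun x => x.2.1.transmission j)
    (fun _ => measurableSet_Ico) (fun x => h.transmission_subset x.2.2 j)
    (measurableSet_Ioc (a := (0 : ℝ)) (b := 1))
  rw [ENNReal.tsum_sigma', tsum_fintype] at h2
  have h3 : P.transmitting (E.visits ω) i j
      = ⋃ x : Σ l, E.visits ω l i, x.2.1.transmission j := by
    ext t
    simp only [transmitting, mem_ofPred_eq, mem_iUnion, Sigma.exists, Subtype.exists, exists_prop]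
  rw [h3]
  exact h2.symm

/-- Mass transport turns presence into the mean total duration of the visits starting in `(0, 1]`;
each duration is grants plus overhead, and the grants average to the arrivals. -/
theorem meanPresence_eq [IsProbabilityMeasure μ] (i : Fin N) :
    E.meanPresence i = ∑ j, ∫⁻ ω, E.arrived ω i j (Ioc 0 1) ∂μ
      + E.visitSum i (fun _ _ => P.overhead i) := by
  have hg : ∀ j : Fin (P.numQueues i), Measurable
      ({v : P.Visit i | v.start ∈ Ioc 0 1}.indicator fun v => ENNReal.ofReal (v.grant j)) :=
    fun j => measurable_indicator_start (Visit.measurable_grant j).ennreal_ofReal 0 1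
  have ho : Measurable
      ({v : P.Visit i | v.start ∈ Ioc 0 1}.indicator fun _ => ENNReal.ofReal (P.overhead i)) :=
    measurable_indicator_start measurable_const 0 1
  rw [E.visitSum_eq_sum_pointSum measurable_const]
  simp_rw [← E.sum_lintegral_pointSum_grant]
  rw [Finset.sum_comm, ← Finset.sum_add_distrib, meanPresence]
  refine Finset.sum_congr rfl fun l _ => ?_
  rw [← lintegral_finsetSum' _ fun j _ => E.aemeasurable_pointSum l (hg j),
    ← lintegral_add_right' _ (E.aemeasurable_pointSum l ho)]
  refine (E.lintegral_pointSum_length l Visit.measurable_start Visit.measurable_finish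
    (fun t v => v.start_delay t) (fun t v => v.finish_delay t)).symm.trans (lintegral_congr_ae ?_)
  filter_upwards [E.isTrajectory] with ω h
  simp only [pointSum]
  rw [← tsum_fintype (L := SummationFilter.unconditional _), ENNReal.tsum_comm,
    ← ENNReal.tsum_add]
  refine tsum_congr fun v => ?_
  have hgr := h.grant_nonneg l i v v.2
  by_cases hv : v.1 ∈ {v : P.Visit i | v.start ∈ Ioc 0 1}
  · simp only [indicator_of_mem hv]
    rw [tsum_fintype, ← ENNReal.ofReal_sum_of_nonneg fun j _ => hgr j,
      ← ENNReal.ofReal_add (Finset.sum_nonneg fun j _ => hgr j) (P.overhead_pos i).le]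
    congr 1
    simp only [Visit.finish]
    ring
  · simp only [indicator_of_notMem hv, tsum_zero, add_zero]

theorem visitSum_overhead (i : Fin N) :
    E.visitSum i (fun _ _ => P.overhead i)
      = ENNReal.ofReal (P.overhead i) * E.visitRate i := by
  rw [visitRate, E.visitSum_eq_sum_pointSum measurable_const,
    E.visitSum_eq_sum_pointSum measurable_const, Finset.mul_sum]
  refine Finset.sum_congr rfl fun l _ => ?_
  rw [← lintegral_const_mul'' _ (E.aemeasurable_pointSum l
    (measurable_indicator_start measurable_const 0 1))]
  refine lintegral_congr fun ω => ?_
  rw [pointSum, pointSum, ← ENNReal.tsum_mul_left]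
  refine tsum_congr fun v => ?_
  by_cases hv : v.1 ∈ {v : P.Visit i | v.start ∈ Ioc 0 1}
  · simp only [indicator_of_mem hv, ENNReal.ofReal_one, mul_one]
  · simp only [indicator_of_notMem hv, mul_zero]

/-- If the rate were zero, stationarity would exclude starts in every unit window almost surely,
contradicting `visited_after`. -/
theorem visitRate_ne_zero [IsProbabilityMeasure μ] (i : Fin N) : E.visitRate i ≠ 0 := by
  intro h0
  rw [visitRate, E.visitSum_eq_sum_pointSum measurable_const, Finset.sum_eq_zero_iff] at h0
  have hm : ∀ n : ℤ, Measurable ({v : P.Visit i | v.start ∈ Ioc (n : ℝ) (n + 1)}.indicator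
      fun _ => ENNReal.ofReal 1) := fun n => measurable_indicator_start measurable_const _ _
  have hzero : ∀ l (n : ℤ), ∫⁻ ω, E.pointSum l i
      ({v | v.start ∈ Ioc (n : ℝ) (n + 1)}.indicator fun _ => ENNReal.ofReal 1) ω ∂μ = 0 := by
    intro l n
    rw [← E.lintegral_pointSum_delay l (hm n) n, ← h0 l (Finset.mem_univ l)]
    refine lintegral_congr fun ω => tsum_congr fun v => ?_
    have : v.1.start + n ∈ Ioc (n : ℝ) (n + 1) ↔ v.1.start ∈ Ioc (0 : ℝ) 1 := by
      constructor <;> rintro ⟨h1, h2⟩ <;> constructor <;> linarith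
    simp only [indicator, mem_ofPred_eq, Visit.start_delay, this]
  have hall : ∀ᵐ ω ∂μ, ∀ l, ∀ n : ℤ, E.pointSum l i
      ({v | v.start ∈ Ioc (n : ℝ) (n + 1)}.indicator fun _ => ENNReal.ofReal 1) ω = 0 := by
    rw [ae_all_iff]
    intro l
    rw [ae_all_iff]
    intro n
    exact (lintegral_eq_zero_iff' (E.aemeasurable_pointSum l (hm n))).1 (hzero l n)
  obtain ⟨ω, hω, h⟩ := (hall.and E.isTrajectory).exists
  obtain ⟨l, v, hv, -⟩ := h.visited_after i 0
  obtain ⟨n, hn⟩ := mem_iUnion.1 (iUnion_Ioc_intCast ℝ ▸ mem_univ v.start)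
  have := ENNReal.tsum_eq_zero.1 (hω l n) ⟨v, hv⟩
  rw [indicator_of_mem (by exact hn)] at this
  simp at this

end Equilibrium
end PON
-- The mean vacation formula
theorem mainTheorem7 {N L : ℕ} (hL : 0 < L) (P : PON N L)
    {Ω : Type*} [MeasurableSpace Ω] (μ : Measure Ω) [IsProbabilityMeasure μ]
    (E : P.Equilibrium μ) :
    (∀ i, E.visitRate i ≠ 0 ∧ E.visitRate i ≠ ∞ ∧ E.meanVacationAt i ≠ ∞) ∧
    E.meanVacation ≠ ∞ ∧ E.meanOverhead ≠ 0 ∧ E.meanOverhead ≠ ∞ ∧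
    E.intensity < L ∧
    E.meanVacation.toReal =
      ((N : ℝ) - (L : ℝ)) * E.meanOverhead.toReal / ((L : ℝ) - E.intensity) ∧
    (∀ θ : ℝ, (∀ i, (E.meanVacationAt i).toReal = θ) →
      θ = ((N : ℝ) - (L : ℝ)) * E.meanOverhead.toReal / ((L : ℝ) - E.intensity)) := by
  have hN : Nonempty (Fin N) := by
    by_contra hempty
    rw [not_nonempty_iff] at hempty
    have := E.sum_meanPresence
    rw [Finset.univ_eq_empty, Finset.sum_empty] at this
    exact hL.ne (by exact_mod_cast this)
  set Λ := ∑ i, E.visitRate i with hΛ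
  set V := ∑ i, E.visitSum i (fun ω v => E.vacation ω i v) with hV
  set O := ∑ i, E.visitSum i (fun _ _ => P.overhead i) with hO
  set A := ∑ i, ∑ j, ∫⁻ ω, E.arrived ω i j (Ioc 0 1) ∂μ with hA
  have hVL : V + L = N := by
    rw [hV, ← E.sum_meanPresence, ← Finset.sum_add_distrib]
    simp [E.visitSum_vacation_add_meanPresence]
  have hAO : A + O = L := by
    rw [← E.sum_meanPresence, hA, hO, ← Finset.sum_add_distrib]
    exact Finset.sum_congr rfl fun i _ => (E.meanPresence_eq i).symm
  have hV_top : V ≠ ∞ := ne_top_of_le_ne_top (ENNReal.natCast_ne_top N) (hVL ▸ le_self_add)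
  have hA_top : A ≠ ∞ := ne_top_of_le_ne_top (ENNReal.natCast_ne_top L) (hAO ▸ le_self_add)
  have hO_top : O ≠ ∞ := ne_top_of_le_ne_top (ENNReal.natCast_ne_top L) (hAO ▸ le_add_self)
  have hVi (i) : E.visitSum i (fun ω v => E.vacation ω i v) ≠ ∞ := ENNReal.sum_ne_top.1 hV_top i
    (Finset.mem_univ i)
  have hrate0 := E.visitRate_ne_zero
  have hover (i) : ENNReal.ofReal (P.overhead i) ≠ 0 :=
    (ENNReal.ofReal_pos.2 (P.overhead_pos i)).ne'
  -- The overhead time `Δ_i λ_i` is bounded by `L`, and `Δ_i > 0`.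
  have hrate (i) : E.visitRate i ≠ ∞ := by
    have := ENNReal.sum_ne_top.1 hO_top i (Finset.mem_univ i)
    rw [E.visitSum_overhead] at this
    intro h
    rw [h, ENNReal.mul_top (hover i)] at this
    exact this rfl
  have hΛ0 : Λ ≠ 0 := fun h => hrate0 hN.some
    (Finset.sum_eq_zero_iff.1 h _ (Finset.mem_univ hN.some))
  have hΛ_top : Λ ≠ ∞ := ENNReal.sum_ne_top.2 fun i _ => hrate i
  have hO0 : O ≠ 0 := fun h => by
    have := Finset.sum_eq_zero_iff.1 h _ (Finset.mem_univ hN.some)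
    rw [E.visitSum_overhead, mul_eq_zero] at this
    exact this.elim (hover _) (hrate0 _)
  have hintensity : E.intensity = A.toReal := by
    have hAi := fun i => ENNReal.sum_ne_top.1 hA_top i (Finset.mem_univ i)
    rw [hA, ENNReal.toReal_sum fun i _ => hAi i, PON.Equilibrium.intensity]
    refine Finset.sum_congr rfl fun i _ => ?_
    rw [ENNReal.toReal_sum fun j _ => E.rate_ne_top i j]
    rfl
  have hVL' : V.toReal = N - L := by
    have := congrArg ENNReal.toReal hVL
    rw [ENNReal.toReal_add hV_top (ENNReal.natCast_ne_top L)] at this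
    simp only [ENNReal.toReal_natCast] at this
    linarith
  have hAO' : O.toReal = L - E.intensity := by
    have := congrArg ENNReal.toReal hAO
    rw [ENNReal.toReal_add hA_top hO_top, ENNReal.toReal_natCast] at this
    linarith
  have hO_pos : 0 < O.toReal := ENNReal.toReal_pos hO0 hO_top
  have hΛ_pos : 0 < Λ.toReal := ENNReal.toReal_pos hΛ0 hΛ_top
  have hδ : E.meanOverhead = O / Λ := rfl
  have hθ : E.meanVacation = V / Λ := rfl
  have hmain : E.meanVacation.toReal
      = ((N : ℝ) - (L : ℝ)) * E.meanOverhead.toReal / ((L : ℝ) - E.intensity) := by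
    rw [hδ, hθ, ENNReal.toReal_div, ENNReal.toReal_div, ← hVL', ← hAO']
    field_simp
  refine ⟨fun i => ⟨hrate0 i, hrate i, ENNReal.div_ne_top (hVi i) (hrate0 i)⟩,
    ENNReal.div_ne_top hV_top hΛ0, ENNReal.div_ne_zero.2 ⟨hO0, hΛ_top⟩,
    ENNReal.div_ne_top hO_top hΛ0, by linarith, hmain, fun θ hall => ?_⟩
  -- With a common mean `θ`, the total vacation `V` is `∑ λ_i θ = θ Λ`.
  rw [← hmain, hθ, ENNReal.toReal_div, eq_div_iff hΛ_pos.ne', hV, hΛ,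
    ENNReal.toReal_sum fun i _ => hVi i, ENNReal.toReal_sum fun i _ => hrate i, Finset.mul_sum]
  refine Finset.sum_congr rfl fun i _ => ?_
  rw [← hall i, PON.Equilibrium.meanVacationAt, ENNReal.toReal_div,
    div_mul_cancel₀ _ (ENNReal.toReal_pos (hrate0 i) (hrate i)).ne']
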